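/- **Setting.** Let $n\in\mathbb N=\{1,2,\dots\}$. A cube of $\mathbb R^n$ has finite edge length and edges parallel to the coordinate axes, and need not be open or closed. For $\ell\in(0,\infty)$ let $\Pi_\ell$ be the class of all collections $\{Q_j\}_j$ of cubes of $\mathbb R^n$ with pairwise disjoint interiors and equal edge length $\ell$. For $p,q\in[1,\infty)$ and $\alpha\in\mathbb R$, the space $JNQ^\alpha_{p,q}(\mathbb R^n)$ is the set of all Lebesgue measurable, almost everywhere finite, real-valued functions $f$ on $\mathbb R^n$ such that $$\|f\|_{JNQ^\alpha_{p,q}(\mathbb R^n)}:=\sup_{\ell\in(0,\infty),\ \{Q_j\}_j\in\Pi_\ell}\Big\{\sum_j|Q_j|\Big[|Q_j|^{\frac{q\alpha}{n}-1}\int_{Q_j}\int_{Q_j}\frac{|f(x)-f(y)|^q}{|x-y|^{n+q\alpha}}\,dy\,dx\Big]^{\frac pq}\Big\}^{\frac1p}<\infty .$$ For $L:\mathbb R\to\mathbb R$ let $\mathscr C_L(f):=L\circ f$. The operator $\mathscr C_L$ is said to be bounded on $JNQ^\alpha_{p,q}(\mathbb R^n)$ if there is a constant $C\in[0,\infty)$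 such that, for every $f\in JNQ^\alpha_{p,q}(\mathbb R^n)$, one has $\mathscr C_L(f)\in JNQ^\alpha_{p,q}(\mathbb R^n)$ and $\|\mathscr C_L(f)\|_{JNQ^\alpha_{p,q}(\mathbb R^n)}\le C\|f\|_{JNQ^\alpha_{p,q}(\mathbb R^n)}$. **Theorem 4.1.** Let $\alpha\in(-\infty,1)$, $p,q\in[1,\infty)$ and $\gamma\in[q,\infty)$ with $\frac1\gamma=\frac1p+\frac1n$. (i) For every continuous $L:\mathbb R\to\mathbb R$, the operator $\mathscr C_L$ is bounded on $JNQ^\alpha_{p,q}(\mathbb R^n)$ if and only if $L$ is Lipschitz, that is, $\sup_{s\ne t}|L(s)-L(t)|/|s-t|<\infty$. (ii) A function $f:\mathbb R^n\to\mathbb R$ belongs to $JNQ^\alpha_{p,q}(\mathbb R^n)$ if and only if there exists $g\in JNQ^\alpha_{p,q}(\mathbb R^n)$ such that $g\neq0$ almost everywhere, $\frac1g\in JNQ^\alpha_{p,q}(\mathbb R^n)$, and $f=g-\frac1g$ almost everywhere. -/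

import Mathlib

open MeasureTheory Set
open scoped ENNReal NNReal

/-- `Q` is a cube of edge length `ℓ` in `ℝⁿ` with edges parallel to the coordinate axes:
a product of intervals `I i` with endpoints `a i` and `a i + ℓ`, each of which may or may not
contain its endpoints. -/
def IsCube {n : ℕ} (ℓ : ℝ) (Q : Set (EuclideanSpace ℝ (Fin n))) : Prop :=
  ∃ (a : Fin n → ℝ) (I : Fin n → Set ℝ),
    (∀ i, Ioo (a i) (a i + ℓ) ⊆ I i ∧ I i ⊆ Icc (a i) (a i + ℓ)) ∧
    Q = {x | ∀ i, x i ∈ I i}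

/-- The class `Π_ℓ` of all collections of cubes of edge length `ℓ` with pairwise disjoint
interiors. (For `ℓ > 0` and `n ≥ 1` such a collection is countable and has no repetitions.) -/
def congruentCubes (n : ℕ) (ℓ : ℝ) : Set (Set (Set (EuclideanSpace ℝ (Fin n)))) :=
  {𝒬 | (∀ Q ∈ 𝒬, IsCube ℓ Q) ∧
    𝒬.Pairwise fun Q R => Disjoint (interior Q) (interior R)}

/-- `Φ_{f,q,α}(Q) = [|Q|^{qα/n - 1} ∫_Q ∫_Q |f(x) - f(y)|^q / |x - y|^{n + qα} dy dx]^{1/q}`,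
with values in `[0, ∞]`. On the diagonal the integrand is `0`. -/
noncomputable def jnqPhi {n : ℕ} (f : EuclideanSpace ℝ (Fin n) → ℝ) (q α : ℝ)
    (Q : Set (EuclideanSpace ℝ (Fin n))) : ℝ≥0∞ :=
  (volume Q ^ (q * α / n - 1) *
    ∫⁻ x in Q, ∫⁻ y in Q, ‖f x - f y‖ₑ ^ q / ‖x - y‖ₑ ^ ((n : ℝ) + q * α)) ^ (1 / q)

/-- The `JNQ^α_{p,q}(ℝⁿ)` norm, with values in `[0, ∞]`. -/
noncomputable def jnqNorm {n : ℕ} (α p q : ℝ) (f : EuclideanSpace ℝ (Fin n) → ℝ) : ℝ≥0∞ :=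
  ⨆ (ℓ : ℝ) (_ : 0 < ℓ) (𝒬 ∈ congruentCubes n ℓ),
    (∑' Q : 𝒬, volume (Q : Set (EuclideanSpace ℝ (Fin n))) * jnqPhi f q α Q ^ p) ^ (1 / p)

/-- `f` belongs to `JNQ^α_{p,q}(ℝⁿ)`: it is Lebesgue measurable, that is, almost everywhere equal
to a Borel function, and its norm is finite. -/
def MemJNQ {n : ℕ} (α p q : ℝ) (f : EuclideanSpace ℝ (Fin n) → ℝ) : Prop :=
  AEMeasurable f volume ∧ jnqNorm α p q f < ∞

/-- The left composition operator `f ↦ L ∘ f` is bounded on `JNQ^α_{p,q}(ℝⁿ)`. -/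
def LeftCompBounded (n : ℕ) (α p q : ℝ) (L : ℝ → ℝ) : Prop :=
  ∃ C : ℝ≥0, ∀ f : EuclideanSpace ℝ (Fin n) → ℝ, MemJNQ α p q f →
    MemJNQ α p q (fun x => L (f x)) ∧
      jnqNorm α p q (fun x => L (f x)) ≤ C * jnqNorm α p q f

/-! A Lipschitz `L` enlarges each difference `|f x - f y|` by at most its constant, hence also the
norm. For the converse one bump `φ`, equal to `1` on the unit ball and `0` off the ball of radius
`2`, suffices: `f = s + (t - s) φ` has norm at most `|t - s| ‖φ‖`, while `L ∘ f` equals `L t` and `L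
s` on these two regions, so a single cube meeting both bounds its norm below by `κ |L t - L s|`.

The substance is `‖φ‖ < ∞` (`jnqNorm_lt_top_of_support_subset`). Raise `α` to some `β ∈ (0, 1)`, so
that `min(1, |z|)^q / |z|^(n + qβ)` is integrable. With `B` the ball of radius `2` and `m = |B ∩
Q|`, each term of the norm is then at most a constant times `ℓ^n (ℓ^(qβ - n) m)^(p/q)`, which is
`O(m)`: for `ℓ ≤ 1` because `m ≤ ℓ^n`, for `ℓ ≥ 1` because `1/p + 1/n ≤ 1/q` makes the remaining
power of `ℓ` nonpositive. The `m` sum to at most `|B|`.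

For (ii), `g = (f + √(f² + 4)) / 2` solves `g - 1/g = f`, and both `g` and `1/g` are Lipschitz
functions of `f`; the converse is a quasi-triangle inequality. -/

/-- The truncated Riesz kernel is integrable. -/
lemma lintegral_min_one_enorm_rpow_div_lt_top {E : Type*} [NormedAddCommGroup E] [NormedSpace ℝ E]
    [FiniteDimensional ℝ E] [MeasurableSpace E] [BorelSpace E] (μ : Measure E)
    [μ.IsAddHaarMeasure] (hd : 1 ≤ Module.finrank ℝ E) {q s : ℝ} (hq : 0 < q)
    (hs : (Module.finrank ℝ E : ℝ) < s) (hsq : s < Module.finrank ℝ E + q) :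
    ∫⁻ z, min 1 ‖z‖ₑ ^ q / ‖z‖ₑ ^ s ∂μ < ∞ := by
  have hs0 : 0 < s := lt_of_le_of_lt (Nat.cast_nonneg _) hs
  -- Inside the unit ball the integrand is at most `|z|^(q - s)` with `s - q < d`; outside it is at
  -- most `|z|^(-s)` with `s > d`, where `d` is the dimension.
  rw [← lintegral_add_compl _ (measurableSet_ball (x := (0 : E)) (ε := 1)), ENNReal.add_lt_top]
  constructor
  · have h : IntegrableOn (fun z : E => ‖z‖ ^ (q - s)) (Metric.ball 0 1) μ := by
      refine integrableOn_ball_of_norm_le_rpow hd (C := 1) (α := s - q) (by linarith)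
        (Filter.Eventually.of_forall fun z => ?_)
        (measurable_norm.pow_const _).aestronglyMeasurable
      rw [Real.norm_of_nonneg (by positivity), one_mul, neg_sub]
    refine lt_of_le_of_lt (setLIntegral_mono' measurableSet_ball fun z hz => ?_)
      h.hasFiniteIntegral
    rcases eq_or_ne z 0 with rfl | hz0
    · simp [hq]
    have hz1 : 0 < ‖z‖ := norm_pos_iff.2 hz0
    have h0 : ‖z‖ₑ ≠ 0 := enorm_ne_zero.2 hz0
    calc min 1 ‖z‖ₑ ^ q / ‖z‖ₑ ^ s ≤ ‖z‖ₑ ^ q / ‖z‖ₑ ^ s := by gcongr; exact min_le_right _ _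
      _ = ‖z‖ₑ ^ (q - s) := (ENNReal.rpow_sub _ _ h0 enorm_ne_top).symm
      _ = ‖‖z‖ ^ (q - s)‖ₑ := by
        rw [Real.enorm_of_nonneg (by positivity), ← ENNReal.ofReal_rpow_of_pos hz1,
          ofReal_norm]
      _ ≤ _ := le_rfl
  · have h := finite_integral_one_add_norm (μ := μ) hs
    -- The factor `2 ^ s` comes from `1 + |z| ≤ 2 |z|` off the unit ball.
    refine lt_of_le_of_lt (b := ENNReal.ofReal (2 ^ s) *
      ∫⁻ z : E, ENNReal.ofReal ((1 + ‖z‖) ^ (-s)) ∂μ) ?_ (ENNReal.mul_lt_top (by simp) h)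
    rw [← lintegral_const_mul' _ _ (by simp)]
    refine le_trans ?_ (setLIntegral_le_lintegral (Metric.ball (0 : E) 1)ᶜ _)
    refine setLIntegral_mono' measurableSet_ball.compl fun z hz => ?_
    have hz1 : 1 ≤ ‖z‖ := by simpa using hz
    have hz0 : 0 < ‖z‖ := by linarith
    calc min 1 ‖z‖ₑ ^ q / ‖z‖ₑ ^ s ≤ 1 ^ q / ‖z‖ₑ ^ s := by gcongr; exact min_le_left _ _
      _ = ENNReal.ofReal (‖z‖ ^ (-s)) := by
        rw [ENNReal.one_rpow, one_div, ← ENNReal.rpow_neg, ← ENNReal.ofReal_rpow_of_pos hz0,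
          ofReal_norm]
      _ ≤ ENNReal.ofReal (2 ^ s * (1 + ‖z‖) ^ (-s)) := by
        apply ENNReal.ofReal_le_ofReal
        rw [Real.rpow_neg hz0.le, Real.rpow_neg (by positivity), ← div_eq_mul_inv,
          ← Real.div_rpow (by norm_num) (by positivity), ← Real.inv_rpow hz0.le]
        refine Real.rpow_le_rpow (by positivity) ?_ hs0.le
        rw [inv_eq_one_div, div_le_div_iff₀ hz0 (by positivity)]
        linarith
      _ = _ := ENNReal.ofReal_mul (by positivity)

section

variable {n : ℕ}

/-! ### Geometry and volume of cubes -/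

lemma IsCube.norm_sub_le {ℓ : ℝ} {Q : Set (EuclideanSpace ℝ (Fin n))} (hℓ : 0 ≤ ℓ)
    (hQ : IsCube ℓ Q) {x y : EuclideanSpace ℝ (Fin n)} (hx : x ∈ Q) (hy : y ∈ Q) :
    ‖x - y‖ ≤ √n * ℓ := by
  obtain ⟨a, I, hI, rfl⟩ := hQ
  rw [EuclideanSpace.norm_eq]
  have h : ∑ i, ‖(x - y) i‖ ^ 2 ≤ n * ℓ ^ 2 := by
    calc ∑ i, ‖(x - y) i‖ ^ 2 ≤ ∑ _i : Fin n, ℓ ^ 2 := by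
          refine Finset.sum_le_sum fun i _ => ?_
          have h1 := (hI i).2 (hx i)
          have h2 := (hI i).2 (hy i)
          rw [Real.norm_eq_abs, sq_abs]
          refine sq_le_sq' ?_ ?_ <;> simp only [PiLp.sub_apply] <;> linarith [h1.1, h1.2, h2.1, h2.2]
      _ = n * ℓ ^ 2 := by simp
  calc √(∑ i, ‖(x - y) i‖ ^ 2) ≤ √(n * ℓ ^ 2) := Real.sqrt_le_sqrt h
    _ = √n * ℓ := by rw [Real.sqrt_mul (by positivity), Real.sqrt_sq hℓ]

/-- Sandwiching between the open and closed boxes avoids any case distinction on which endpoints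
belong to the cube. -/
lemma IsCube.exists_open_closed_boxes {ℓ : ℝ} {Q : Set (EuclideanSpace ℝ (Fin n))}
    (hQ : IsCube ℓ Q) :
    ∃ U V : Set (EuclideanSpace ℝ (Fin n)), IsOpen U ∧ U ⊆ Q ∧ Q ⊆ V ∧
      U =ᵐ[volume] V ∧ volume V = ENNReal.ofReal ℓ ^ n := by
  obtain ⟨a, I, hI, rfl⟩ := hQ
  have hmp := EuclideanSpace.volume_preserving_symm_measurableEquiv_toLp (Fin n)
  refine ⟨WithLp.ofLp ⁻¹' (univ.pi fun i => Ioo (a i) (a i + ℓ)),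
    WithLp.ofLp ⁻¹' (univ.pi fun i => Icc (a i) (a i + ℓ)), ?_, ?_, ?_, ?_, ?_⟩
  · exact (isOpen_set_pi finite_univ fun i _ => isOpen_Ioo).preimage (PiLp.continuous_ofLp 2 _)
  · exact fun x hx i => (hI i).1 (hx i trivial)
  · exact fun x hx i _ => (hI i).2 (hx i)
  · exact hmp.quasiMeasurePreserving.preimage_ae_eq
      (by rw [volume_pi, pi_univ_Icc]; exact Measure.univ_pi_Ioo_ae_eq_Icc)
  · have := hmp.measure_preimage
      (MeasurableSet.univ_pi fun i => measurableSet_Icc (a := a i) (b := a i + ℓ)).nullMeasurableSet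
    refine this.trans ?_
    rw [volume_pi_pi]
    simp

lemma IsCube.volume_eq {ℓ : ℝ} {Q : Set (EuclideanSpace ℝ (Fin n))} (hQ : IsCube ℓ Q) :
    volume Q = ENNReal.ofReal ℓ ^ n := by
  obtain ⟨U, V, -, hUQ, hQV, hUV, hV⟩ := hQ.exists_open_closed_boxes
  exact le_antisymm (hV ▸ measure_mono hQV) (hV ▸ measure_congr hUV ▸ measure_mono hUQ)

lemma IsCube.ae_eq_interior {ℓ : ℝ} {Q : Set (EuclideanSpace ℝ (Fin n))} (hQ : IsCube ℓ Q) :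
    Q =ᵐ[volume] interior Q := by
  obtain ⟨U, V, hU, hUQ, hQV, hUV, hV⟩ := hQ.exists_open_closed_boxes
  refine Filter.EventuallyLE.antisymm ?_ interior_subset.eventuallyLE
  exact hQV.eventuallyLE.trans (hUV.symm.le.trans (interior_maximal hUQ hU).eventuallyLE)

/-- Boundaries of cubes are null, so the cubes may be replaced by their disjoint open interiors. -/
lemma tsum_volume_inter_le {ℓ : ℝ} {𝒬 : Set (Set (EuclideanSpace ℝ (Fin n)))}
    (h𝒬 : 𝒬 ∈ congruentCubes n ℓ) {B : Set (EuclideanSpace ℝ (Fin n))} (hB : MeasurableSet B) :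
    ∑' Q : 𝒬, volume (B ∩ Q) ≤ volume B := by
  calc ∑' Q : 𝒬, volume (B ∩ Q) = ∑' Q : 𝒬, volume (B ∩ interior Q) :=
        tsum_congr fun Q => measure_congr
          (Filter.EventuallyEq.rfl.inter (h𝒬.1 Q Q.2).ae_eq_interior)
    _ ≤ volume (⋃ Q : 𝒬, B ∩ interior Q) := by
        refine tsum_meas_le_meas_iUnion_of_disjoint _
          (fun Q => hB.inter isOpen_interior.measurableSet) fun Q R hQR => ?_
        exact (h𝒬.2 Q.2 R.2 (Subtype.coe_injective.ne hQR)).mono inter_subset_right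
          inter_subset_right
    _ ≤ volume B := measure_mono (iUnion_subset fun Q => inter_subset_left)

/-! ### Energy estimates and finiteness of the norm of a bump -/

/-- The double integral `∫_Q ∫_Q |f(x) - f(y)|^q / |x - y|^s dy dx`. -/
noncomputable def jnqEnergy (f : EuclideanSpace ℝ (Fin n) → ℝ) (q s : ℝ)
    (Q : Set (EuclideanSpace ℝ (Fin n))) : ℝ≥0∞ :=
  ∫⁻ x in Q, ∫⁻ y in Q, ‖f x - f y‖ₑ ^ q / ‖x - y‖ₑ ^ s

lemma jnqPhi_eq (f : EuclideanSpace ℝ (Fin n) → ℝ) (q α : ℝ)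
    (Q : Set (EuclideanSpace ℝ (Fin n))) :
    jnqPhi f q α Q = (volume Q ^ (q * α / n - 1) * jnqEnergy f q (n + q * α) Q) ^ (1 / q) := rfl

lemma jnqNorm_le {α p q : ℝ} {f : EuclideanSpace ℝ (Fin n) → ℝ} {M : ℝ≥0∞} (hp : 0 ≤ p)
    (h : ∀ ℓ : ℝ, 0 < ℓ → ∀ 𝒬 ∈ congruentCubes n ℓ,
      ∑' Q : 𝒬, volume (Q : Set (EuclideanSpace ℝ (Fin n))) * jnqPhi f q α Q ^ p ≤ M) :
    jnqNorm α p q f ≤ M ^ (1 / p) :=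
  iSup_le fun ℓ => iSup_le fun hℓ => iSup₂_le fun 𝒬 h𝒬 =>
    ENNReal.rpow_le_rpow (h ℓ hℓ 𝒬 h𝒬) (by positivity)

lemma tsum_le_jnqNorm_rpow {α p q : ℝ} (f : EuclideanSpace ℝ (Fin n) → ℝ) (hp : 0 < p)
    {ℓ : ℝ} (hℓ : 0 < ℓ) {𝒬 : Set (Set (EuclideanSpace ℝ (Fin n)))}
    (h𝒬 : 𝒬 ∈ congruentCubes n ℓ) :
    ∑' Q : 𝒬, volume (Q : Set (EuclideanSpace ℝ (Fin n))) * jnqPhi f q α Q ^ p ≤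
      jnqNorm α p q f ^ p := by
  rw [← ENNReal.rpow_inv_le_iff hp, ← one_div]
  exact le_iSup_of_le ℓ (le_iSup_of_le hℓ (le_iSup₂_of_le 𝒬 h𝒬 le_rfl))

/-- Since `|x - y| ≤ √n ℓ` on the cube, the surplus power `|x - y|^(t - s)` can be pulled out. This
is how `α` gets raised to a positive exponent. -/
lemma IsCube.jnqEnergy_le_of_le {ℓ : ℝ} {Q : Set (EuclideanSpace ℝ (Fin n))} (hℓ : 0 ≤ ℓ)
    (hQ : IsCube ℓ Q) (f : EuclideanSpace ℝ (Fin n) → ℝ) {q s t : ℝ} (hq : 0 < q) (hst : s ≤ t) :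
    jnqEnergy f q s Q ≤ ENNReal.ofReal (√n * ℓ) ^ (t - s) * jnqEnergy f q t Q := by
  have hmem : ∀ᵐ x ∂volume.restrict Q, x ∈ Q :=
    ae_restrict_mem₀ ((isOpen_interior.measurableSet.nullMeasurableSet).congr
      hQ.ae_eq_interior.symm)
  have htop : ENNReal.ofReal (√n * ℓ) ^ (t - s) ≠ ∞ :=
    ENNReal.rpow_ne_top_of_nonneg (by linarith) ENNReal.ofReal_ne_top
  unfold jnqEnergy
  rw [← lintegral_const_mul' _ _ htop]
  refine lintegral_mono_ae (hmem.mono fun x hx => ?_)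
  rw [← lintegral_const_mul' _ _ htop]
  refine lintegral_mono_ae (hmem.mono fun y hy => ?_)
  rcases eq_or_ne x y with rfl | hxy
  · simp [hq]
  have h0 : ‖x - y‖ₑ ≠ 0 := enorm_ne_zero.2 (sub_ne_zero.2 hxy)
  have hD : ‖x - y‖ₑ ≤ ENNReal.ofReal (√n * ℓ) := by
    rw [← ofReal_norm]
    exact ENNReal.ofReal_le_ofReal (hQ.norm_sub_le hℓ hx hy)
  calc ‖f x - f y‖ₑ ^ q / ‖x - y‖ₑ ^ s
      = ‖x - y‖ₑ ^ (t - s) * (‖f x - f y‖ₑ ^ q / ‖x - y‖ₑ ^ t) := by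
        rw [div_eq_mul_inv, div_eq_mul_inv, ← ENNReal.rpow_neg, ← ENNReal.rpow_neg,
          mul_left_comm, ← ENNReal.rpow_add _ _ h0 enorm_ne_top]
        congr 2
        ring
    _ ≤ _ := by gcongr

/-- The integrand vanishes unless `x` or `y` lies in `B`; integrating the translated kernel over the
other variable costs at most its total mass. Having `B ∩ Q` instead of `Q` on the right makes the
bound summable over cubes. -/
lemma jnqEnergy_le_of_support_subset {f : EuclideanSpace ℝ (Fin n) → ℝ}
    {B : Set (EuclideanSpace ℝ (Fin n))} (hB : MeasurableSet B) (hfB : ∀ x, x ∉ B → f x = 0)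
    {q : ℝ} (hq : 0 < q) (hf : ∀ x y, ‖f x - f y‖ₑ ≤ min 1 ‖x - y‖ₑ) (s : ℝ)
    (Q : Set (EuclideanSpace ℝ (Fin n))) :
    jnqEnergy f q s Q ≤
      2 * (∫⁻ z : EuclideanSpace ℝ (Fin n), min 1 ‖z‖ₑ ^ q / ‖z‖ₑ ^ s) * volume (B ∩ Q) := by
  set G : EuclideanSpace ℝ (Fin n) → ℝ≥0∞ := fun z => min 1 ‖z‖ₑ ^ q / ‖z‖ₑ ^ s with hG
  have hGm : Measurable G := by fun_prop
  set K := ∫⁻ z, G z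
  have hKx : ∀ x, ∫⁻ y in Q, G (x - y) ≤ K := fun x =>
    (setLIntegral_le_lintegral _ _).trans (lintegral_sub_left_eq_self G x).le
  have hKy : ∀ y, ∫⁻ x in Q, G (x - y) ≤ K := fun y =>
    (setLIntegral_le_lintegral _ _).trans (lintegral_sub_right_eq_self G y).le
  have hind : Measurable (B.indicator (1 : EuclideanSpace ℝ (Fin n) → ℝ≥0∞)) :=
    measurable_one.indicator hB
  have hint : ∫⁻ x in Q, B.indicator 1 x * K = K * volume (B ∩ Q) := by
    rw [lintegral_mul_const _ hind, lintegral_indicator_one hB, Measure.restrict_apply hB, mul_comm]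
  have h1 : ∫⁻ x in Q, ∫⁻ y in Q, B.indicator 1 x * G (x - y) ≤ K * volume (B ∩ Q) := by
    rw [← hint]
    refine lintegral_mono fun x => ?_
    rw [lintegral_const_mul _ (by fun_prop)]
    gcongr
    exact hKx x
  have h2 : ∫⁻ x in Q, ∫⁻ y in Q, B.indicator 1 y * G (x - y) ≤ K * volume (B ∩ Q) := by
    rw [lintegral_lintegral_swap (by fun_prop), ← hint]
    refine lintegral_mono fun y => ?_
    rw [lintegral_const_mul _ (by fun_prop)]
    gcongr
    exact hKy y
  calc jnqEnergy f q s Q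
      ≤ ∫⁻ x in Q, ∫⁻ y in Q, (B.indicator 1 x * G (x - y) + B.indicator 1 y * G (x - y)) := by
        refine lintegral_mono fun x => lintegral_mono fun y => ?_
        have hle : ‖f x - f y‖ₑ ^ q / ‖x - y‖ₑ ^ s ≤ G (x - y) := by
          simp only [hG]
          gcongr
          exact hf x y
        by_cases hx : x ∈ B
        · simpa [hx] using le_add_right hle
        · by_cases hy : y ∈ B
          · simpa [hx, hy] using hle
          · simp [hfB x hx, hfB y hy, hq]
    _ = (∫⁻ x in Q, ∫⁻ y in Q, B.indicator 1 x * G (x - y)) +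
          ∫⁻ x in Q, ∫⁻ y in Q, B.indicator 1 y * G (x - y) := by
        rw [← lintegral_add_left]
        · refine lintegral_congr fun x => ?_
          rw [lintegral_add_left (by fun_prop)]
        · exact Measurable.lintegral_prod_right' (ν := volume.restrict Q)
            (f := fun z => B.indicator 1 z.1 * G (z.1 - z.2)) (by fun_prop)
    _ ≤ K * volume (B ∩ Q) + K * volume (B ∩ Q) := add_le_add h1 h2
    _ = 2 * K * volume (B ∩ Q) := by ring

/-- The exponent bookkeeping behind the finiteness of the norm of a bump function. -/
lemma rpow_mul_rpow_le_of_scaling {L m V : ℝ≥0∞} {n : ℕ} {p q β : ℝ} (hL0 : L ≠ 0) (hL : L ≠ ∞)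
    (hmL : m ≤ L ^ n) (hmV : m ≤ V) (hp : 0 < p) (hq : 0 < q) (hqp : q ≤ p) (hβ : 0 ≤ β)
    (hle : n + p * β ≤ n * (p / q)) :
    L ^ n * (L ^ (q * β - n) * m) ^ (p / q) ≤ (1 + V ^ (p / q - 1)) * m := by
  have hr : 0 ≤ p / q - 1 := by rw [sub_nonneg, one_le_div hq]; exact hqp
  have hsplit : m ^ (p / q) = m ^ (p / q - 1) * m := by
    conv_rhs => rw [← ENNReal.rpow_one m, ← ENNReal.rpow_mul, one_mul]
    rw [← ENNReal.rpow_add_of_nonneg _ _ hr zero_le_one]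
    simp
  rw [ENNReal.mul_rpow_of_nonneg _ _ (by positivity), hsplit, ← mul_assoc, ← mul_assoc,
    ← ENNReal.rpow_mul, ← ENNReal.rpow_natCast, ← ENNReal.rpow_add _ _ hL0 hL]
  have he : n + (q * β - n) * (p / q) = n + p * β - n * (p / q) := by field_simp; ring
  rw [he]
  gcongr
  -- Small cubes use `m ≤ L ^ n`, leaving `L ^ (p * β) ≤ 1`; large cubes use `m ≤ V` and the
  -- nonpositive exponent given by `hle`.
  rcases le_total L 1 with h1 | h1
  · refine le_trans ?_ le_self_add
    calc L ^ (n + p * β - n * (p / q)) * m ^ (p / q - 1)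
        ≤ L ^ (n + p * β - n * (p / q)) * (L ^ (n : ℝ)) ^ (p / q - 1) := by
          gcongr
          rwa [ENNReal.rpow_natCast]
      _ = L ^ (p * β) := by
          rw [← ENNReal.rpow_mul, ← ENNReal.rpow_add _ _ hL0 hL]
          congr 1
          ring
      _ ≤ 1 := ENNReal.rpow_le_one h1 (by positivity)
  · refine le_trans ?_ le_add_self
    calc L ^ (n + p * β - n * (p / q)) * m ^ (p / q - 1)
        ≤ 1 * V ^ (p / q - 1) := by
          gcongr
          calc L ^ (n + p * β - n * (p / q)) ≤ L ^ (0 : ℝ) :=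
                ENNReal.rpow_le_rpow_of_exponent_le h1 (by linarith)
            _ = 1 := ENNReal.rpow_zero
      _ = _ := one_mul _

lemma jnqNorm_lt_top_of_support_subset (hn : 1 ≤ n) {α p q : ℝ} (hα : α < 1) (hp : 1 ≤ p)
    (hq : 1 ≤ q) (hpq : 1 / p + 1 / (n : ℝ) ≤ 1 / q) {f : EuclideanSpace ℝ (Fin n) → ℝ}
    {B : Set (EuclideanSpace ℝ (Fin n))} (hB : MeasurableSet B) (hBf : volume B ≠ ∞)
    (hfB : ∀ x, x ∉ B → f x = 0) (hf : ∀ x y, ‖f x - f y‖ₑ ≤ min 1 ‖x - y‖ₑ) :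
    jnqNorm α p q f < ∞ := by
  have hn0 : (0 : ℝ) < n := by exact_mod_cast hn
  have hp0 : 0 < p := by linarith
  have hq0 : 0 < q := by linarith
  -- The kernel needs `β < 1` at the origin and `β > 0` at infinity.
  obtain ⟨β, hβ0, hβ1, hαβ⟩ : ∃ β : ℝ, 0 < β ∧ β < 1 ∧ α ≤ β :=
    ⟨max α (1 / 2), by positivity, max_lt hα (by norm_num), le_max_left _ _⟩
  have hnp : n + p ≤ n * (p / q) := by
    have := mul_le_mul_of_nonneg_left hpq (by positivity : 0 ≤ n * p)
    calc (n : ℝ) + p = n * p * (1 / p + 1 / n) := by field_simp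
      _ ≤ _ := this
      _ = _ := by ring
  have hqp : q ≤ p := by
    have h : 1 / p ≤ 1 / q := le_trans (by simp) hpq
    exact (one_div_le_one_div hp0 hq0).1 h
  have hK := lintegral_min_one_enorm_rpow_div_lt_top
    (volume : Measure (EuclideanSpace ℝ (Fin n))) (by simpa) hq0 (s := n + q * β)
    (by simp; positivity) (by simp; nlinarith)
  set K := ∫⁻ z : EuclideanSpace ℝ (Fin n), min 1 ‖z‖ₑ ^ q / ‖z‖ₑ ^ (n + q * β)
  set c : ℝ≥0∞ := ENNReal.ofReal (√n) ^ (q * (β - α)) * (2 * K) with hc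
  have hctop : c ≠ ∞ := by
    refine ENNReal.mul_ne_top (ENNReal.rpow_ne_top_of_nonneg ?_ ENNReal.ofReal_ne_top)
      (ENNReal.mul_ne_top (by simp) hK.ne)
    exact mul_nonneg hq0.le (by linarith)
  set V := volume B
  set M : ℝ≥0∞ := c ^ (p / q) * (1 + V ^ (p / q - 1)) with hM
  have hr : 0 ≤ p / q - 1 := by rw [sub_nonneg, one_le_div hq0]; exact hqp
  have hMtop : M ≠ ∞ := by
    refine ENNReal.mul_ne_top (ENNReal.rpow_ne_top_of_nonneg (by positivity) hctop) ?_
    exact ENNReal.add_ne_top.2 ⟨by simp, ENNReal.rpow_ne_top_of_nonneg hr hBf⟩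
  refine lt_of_le_of_lt (jnqNorm_le (M := M * V) hp0.le fun ℓ hℓ 𝒬 h𝒬 => ?_)
    (ENNReal.rpow_lt_top_of_nonneg (by positivity) (ENNReal.mul_ne_top hMtop hBf))
  refine le_trans (ENNReal.tsum_le_tsum fun Q => ?_) (ENNReal.tsum_mul_left.le.trans
    (mul_le_mul_right (tsum_volume_inter_le h𝒬 hB) M))
  have hQ := h𝒬.1 Q Q.2
  set L := ENNReal.ofReal ℓ
  have hL0 : L ≠ 0 := by simpa [L] using hℓ
  have hLtop : L ≠ ∞ := ENNReal.ofReal_ne_top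
  have hvol := hQ.volume_eq
  set m := volume (B ∩ (Q : Set (EuclideanSpace ℝ (Fin n))))
  have hmain := rpow_mul_rpow_le_of_scaling (m := m) (V := V) hL0 hLtop
    (hvol ▸ measure_mono inter_subset_right) (measure_mono inter_subset_left) hp0 hq0 hqp
    hβ0.le (by nlinarith)
  have hE : (L ^ n) ^ (q * α / n - 1) * jnqEnergy f q (n + q * α) Q ≤
      c * (L ^ (q * β - n) * m) := by
    calc (L ^ n) ^ (q * α / n - 1) * jnqEnergy f q (n + q * α) Q
        ≤ (L ^ n) ^ (q * α / n - 1) * (ENNReal.ofReal (√n * ℓ) ^ (n + q * β - (n + q * α)) *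
            (2 * K * m)) := by
          gcongr
          refine (hQ.jnqEnergy_le_of_le hℓ.le f hq0 (t := n + q * β) (by nlinarith)).trans ?_
          gcongr
          exact jnqEnergy_le_of_support_subset hB hfB hq0 hf _ _
      _ = c * ((L ^ (q * α - n) * L ^ (q * (β - α))) * m) := by
          rw [ENNReal.ofReal_mul (by positivity), ENNReal.mul_rpow_of_nonneg _ _ (by nlinarith),
            ← ENNReal.rpow_natCast, ← ENNReal.rpow_mul, hc,
            show n * (q * α / n - 1) = q * α - n by field_simp,
            show n + q * β - (n + q * α) = q * (β - α) by ring]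
          ring
      _ = c * (L ^ (q * β - n) * m) := by
          rw [← ENNReal.rpow_add _ _ hL0 hLtop]
          congr 3
          ring
  calc volume (Q : Set (EuclideanSpace ℝ (Fin n))) * jnqPhi f q α Q ^ p
      ≤ L ^ n * (c * (L ^ (q * β - n) * m)) ^ (p / q) := by
        rw [jnqPhi_eq, ← ENNReal.rpow_mul, hvol, show 1 / q * p = p / q by ring]
        gcongr
    _ = c ^ (p / q) * (L ^ n * (L ^ (q * β - n) * m) ^ (p / q)) := by
        rw [ENNReal.mul_rpow_of_nonneg _ _ (by positivity)]
        ring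
    _ ≤ c ^ (p / q) * ((1 + V ^ (p / q - 1)) * m) := by gcongr
    _ = M * m := by rw [hM, mul_assoc]

/-! ### Stability under a.e. equality, Lipschitz maps and differences -/

lemma jnqEnergy_congr_ae {f g : EuclideanSpace ℝ (Fin n) → ℝ} (h : f =ᵐ[volume] g) (q s : ℝ)
    (Q : Set (EuclideanSpace ℝ (Fin n))) : jnqEnergy f q s Q = jnqEnergy g q s Q := by
  have h' := ae_restrict_of_ae (s := Q) h
  exact lintegral_congr_ae (h'.mono fun x hx => lintegral_congr_ae (h'.mono fun y hy => by
    simp only [hx, hy]))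

lemma jnqNorm_congr_ae {f g : EuclideanSpace ℝ (Fin n) → ℝ} (h : f =ᵐ[volume] g) (α p q : ℝ) :
    jnqNorm α p q f = jnqNorm α p q g := by
  simp only [jnqNorm, jnqPhi_eq, jnqEnergy_congr_ae h]

lemma MemJNQ.congr_ae {α p q : ℝ} {f g : EuclideanSpace ℝ (Fin n) → ℝ} (hf : MemJNQ α p q f)
    (h : f =ᵐ[volume] g) : MemJNQ α p q g :=
  ⟨hf.1.congr h, jnqNorm_congr_ae h α p q ▸ hf.2⟩

lemma jnqPhi_le_mul {f g : EuclideanSpace ℝ (Fin n) → ℝ} {q α : ℝ} (hq : 0 < q) (K : ℝ≥0)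
    (h : ∀ x y, ‖g x - g y‖ₑ ≤ K * ‖f x - f y‖ₑ) (Q : Set (EuclideanSpace ℝ (Fin n))) :
    jnqPhi g q α Q ≤ K * jnqPhi f q α Q := by
  have hE : jnqEnergy g q (n + q * α) Q ≤ (K : ℝ≥0∞) ^ q * jnqEnergy f q (n + q * α) Q := by
    have hK : (K : ℝ≥0∞) ^ q ≠ ∞ := ENNReal.rpow_ne_top_of_nonneg hq.le ENNReal.coe_ne_top
    unfold jnqEnergy
    rw [← lintegral_const_mul' _ _ hK]
    refine lintegral_mono fun x => ?_
    rw [← lintegral_const_mul' _ _ hK]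
    refine lintegral_mono fun y => ?_
    rw [← mul_div_assoc, ← ENNReal.mul_rpow_of_nonneg _ _ hq.le]
    gcongr
    exact h x y
  rw [jnqPhi_eq, jnqPhi_eq]
  calc (volume Q ^ (q * α / n - 1) * jnqEnergy g q (n + q * α) Q) ^ (1 / q)
      ≤ ((K : ℝ≥0∞) ^ q * (volume Q ^ (q * α / n - 1) * jnqEnergy f q (n + q * α) Q)) ^ (1 / q) := by
        rw [mul_left_comm]
        gcongr
    _ = _ := by
        rw [ENNReal.mul_rpow_of_nonneg _ _ (by positivity), ← ENNReal.rpow_mul,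
          mul_one_div_cancel hq.ne', ENNReal.rpow_one]

lemma jnqNorm_le_mul {f g : EuclideanSpace ℝ (Fin n) → ℝ} {α p q : ℝ} (hp : 0 < p) (hq : 0 < q)
    (K : ℝ≥0) (h : ∀ x y, ‖g x - g y‖ₑ ≤ K * ‖f x - f y‖ₑ) :
    jnqNorm α p q g ≤ K * jnqNorm α p q f := by
  refine (jnqNorm_le (M := ((K : ℝ≥0∞) * jnqNorm α p q f) ^ p) hp.le fun ℓ hℓ 𝒬 h𝒬 => ?_).trans_eq ?_
  · rw [ENNReal.mul_rpow_of_nonneg _ _ hp.le]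
    refine le_trans (ENNReal.tsum_le_tsum fun Q => ?_) (ENNReal.tsum_mul_left.le.trans
      (mul_le_mul_right (tsum_le_jnqNorm_rpow f hp hℓ h𝒬) _))
    rw [mul_left_comm, ← ENNReal.mul_rpow_of_nonneg _ _ hp.le]
    gcongr
    exact jnqPhi_le_mul hq K h Q
  · rw [← ENNReal.rpow_mul, mul_one_div_cancel hp.ne', ENNReal.rpow_one]

lemma LipschitzWith.enorm_sub_le {K : ℝ≥0} {L : ℝ → ℝ} (hL : LipschitzWith K L) (s t : ℝ) :
    ‖L s - L t‖ₑ ≤ K * ‖s - t‖ₑ := by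
  simpa only [edist_eq_enorm_sub] using hL s t

lemma LipschitzWith.leftCompBounded {α p q : ℝ} (hp : 0 < p) (hq : 0 < q) {K : ℝ≥0} {L : ℝ → ℝ}
    (hL : LipschitzWith K L) : LeftCompBounded n α p q L := by
  refine ⟨K, fun f hf => ?_⟩
  have h := jnqNorm_le_mul (α := α) hp hq K fun x y => hL.enorm_sub_le (f x) (f y)
  exact ⟨⟨hL.continuous.measurable.comp_aemeasurable hf.1,
    h.trans_lt (ENNReal.mul_lt_top ENNReal.coe_lt_top hf.2)⟩, h⟩

lemma jnqEnergy_sub_le {f g : EuclideanSpace ℝ (Fin n) → ℝ} (hf : AEMeasurable f)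
    (hg : AEMeasurable g) {q : ℝ} (hq : 1 ≤ q) (s : ℝ) (Q : Set (EuclideanSpace ℝ (Fin n))) :
    jnqEnergy (fun x => f x - g x) q s Q ≤
      2 ^ (q - 1) * (jnqEnergy f q s Q + jnqEnergy g q s Q) := by
  -- Splitting the double integral of a sum requires measurability, so Borel representatives are
  -- used.
  wlog hm : Measurable f ∧ Measurable g generalizing f g
  · have := this hf.measurable_mk.aemeasurable hg.measurable_mk.aemeasurable
      ⟨hf.measurable_mk, hg.measurable_mk⟩
    rwa [← jnqEnergy_congr_ae hf.ae_eq_mk, ← jnqEnergy_congr_ae hg.ae_eq_mk,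
      ← jnqEnergy_congr_ae (f := fun x => f x - g x)
        (g := fun x => hf.mk f x - hg.mk g x) (hf.ae_eq_mk.sub hg.ae_eq_mk)] at this
  obtain ⟨hf, hg⟩ := hm
  have hc : (2 : ℝ≥0∞) ^ (q - 1) ≠ ∞ := ENNReal.rpow_ne_top_of_nonneg (by linarith) (by simp)
  unfold jnqEnergy
  rw [← lintegral_add_left, ← lintegral_const_mul' _ _ hc]
  · refine lintegral_mono fun x => ?_
    rw [← lintegral_add_left (by fun_prop), ← lintegral_const_mul' _ _ hc]
    refine lintegral_mono fun y => ?_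
    rw [← ENNReal.add_div, ← mul_div_assoc]
    gcongr
    refine le_trans ?_ (ENNReal.rpow_add_le_mul_rpow_add_rpow _ _ hq)
    gcongr
    rw [sub_sub_sub_comm]
    exact enorm_sub_le
  · exact Measurable.lintegral_prod_right' (ν := volume.restrict Q)
      (f := fun z => ‖f z.1 - f z.2‖ₑ ^ q / ‖z.1 - z.2‖ₑ ^ s) (by fun_prop)

lemma jnqPhi_sub_le {f g : EuclideanSpace ℝ (Fin n) → ℝ} (hf : AEMeasurable f)
    (hg : AEMeasurable g) {q : ℝ} (hq : 1 ≤ q) (α : ℝ) (Q : Set (EuclideanSpace ℝ (Fin n))) :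
    jnqPhi (fun x => f x - g x) q α Q ≤ 2 * (jnqPhi f q α Q + jnqPhi g q α Q) := by
  have hq0 : 0 < q := by linarith
  simp only [jnqPhi_eq]
  set v := volume Q ^ (q * α / n - 1)
  set A := jnqEnergy f q (n + q * α) Q
  set B := jnqEnergy g q (n + q * α) Q
  calc (v * jnqEnergy (fun x => f x - g x) q (n + q * α) Q) ^ (1 / q)
      ≤ (2 ^ q * (v * A + v * B)) ^ (1 / q) := by
        refine ENNReal.rpow_le_rpow ?_ (by positivity)
        calc v * jnqEnergy (fun x => f x - g x) q (n + q * α) Q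
            ≤ v * (2 ^ (q - 1) * (A + B)) := by gcongr; exact jnqEnergy_sub_le hf hg hq _ _
          -- Weakening `2 ^ (q - 1)` to `2 ^ q` makes the `q`-th root exactly `2`; only finiteness
          -- matters later.
          _ ≤ v * (2 ^ q * (A + B)) := by
            gcongr
            · norm_num
            · linarith
          _ = _ := by ring
    _ = 2 * (v * A + v * B) ^ (1 / q) := by
        rw [ENNReal.mul_rpow_of_nonneg _ _ (by positivity), ← ENNReal.rpow_mul,
          mul_one_div_cancel hq0.ne', ENNReal.rpow_one]
    _ ≤ _ := by
        gcongr
        exact ENNReal.rpow_add_le_add_rpow _ _ (by positivity) (by rwa [div_le_one hq0])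

lemma MemJNQ.sub {α p q : ℝ} (hp : 1 ≤ p) (hq : 1 ≤ q) {f g : EuclideanSpace ℝ (Fin n) → ℝ}
    (hf : MemJNQ α p q f) (hg : MemJNQ α p q g) : MemJNQ α p q fun x => f x - g x := by
  have hp0 : 0 < p := by linarith
  refine ⟨hf.1.sub hg.1, ?_⟩
  set c : ℝ≥0∞ := 2 ^ p * 2 ^ (p - 1)
  have hc : c ≠ ∞ := ENNReal.mul_ne_top (ENNReal.rpow_ne_top_of_nonneg hp0.le (by simp))
    (ENNReal.rpow_ne_top_of_nonneg (by linarith) (by simp))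
  refine lt_of_le_of_lt (jnqNorm_le (M := c * (jnqNorm α p q f ^ p + jnqNorm α p q g ^ p)) hp0.le
    fun ℓ hℓ 𝒬 h𝒬 => ?_) (ENNReal.rpow_lt_top_of_nonneg (by positivity) (ENNReal.mul_ne_top hc
      (ENNReal.add_ne_top.2 ⟨ENNReal.rpow_ne_top_of_nonneg hp0.le hf.2.ne,
        ENNReal.rpow_ne_top_of_nonneg hp0.le hg.2.ne⟩)))
  refine le_trans ?_ (mul_le_mul_right (add_le_add (tsum_le_jnqNorm_rpow f hp0 hℓ h𝒬)
    (tsum_le_jnqNorm_rpow g hp0 hℓ h𝒬)) _)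
  rw [← ENNReal.tsum_add, ← ENNReal.tsum_mul_left]
  refine ENNReal.tsum_le_tsum fun Q => ?_
  rw [← mul_add, mul_left_comm]
  gcongr
  calc jnqPhi (fun x => f x - g x) q α Q ^ p
      ≤ (2 * (jnqPhi f q α Q + jnqPhi g q α Q)) ^ p := by
        gcongr
        exact jnqPhi_sub_le hf.1 hg.1 hq α Q
    _ = 2 ^ p * (jnqPhi f q α Q + jnqPhi g q α Q) ^ p := ENNReal.mul_rpow_of_nonneg _ _ hp0.le
    _ ≤ 2 ^ p * (2 ^ (p - 1) * (jnqPhi f q α Q ^ p + jnqPhi g q α Q ^ p)) := by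
        gcongr
        exact ENNReal.rpow_add_le_mul_rpow_add_rpow _ _ hp
    _ = _ := by rw [← mul_assoc]

/-! ### The decomposition `f = g - 1/g` -/

/-- The positive root `u` of `u - 1 / u = t`. -/
noncomputable def posRoot (t : ℝ) : ℝ := (t + √(t ^ 2 + 4)) / 2

lemma posRoot_mul (t : ℝ) : posRoot t * posRoot (-t) = 1 := by
  have h := Real.sq_sqrt (show 0 ≤ t ^ 2 + 4 by positivity)
  simp only [posRoot, neg_sq]
  nlinarith

lemma posRoot_pos (t : ℝ) : 0 < posRoot t := by
  have h : |t| < √(t ^ 2 + 4) := Real.lt_sqrt_of_sq_lt (by rw [sq_abs]; linarith)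
  have := neg_abs_le t
  unfold posRoot
  linarith

lemma one_div_posRoot (t : ℝ) : 1 / posRoot t = posRoot (-t) := by
  rw [div_eq_iff (posRoot_pos t).ne', mul_comm, posRoot_mul]

lemma posRoot_sub_one_div (t : ℝ) : posRoot t - 1 / posRoot t = t := by
  rw [one_div_posRoot]
  simp only [posRoot, neg_sq]
  ring

lemma lipschitzWith_posRoot : LipschitzWith 1 posRoot := by
  refine LipschitzWith.of_le_add fun x y => ?_
  rw [Real.dist_eq]
  have h : √(x ^ 2 + 4) ≤ √(y ^ 2 + 4) + |x - y| := by
    rw [Real.sqrt_le_left (by positivity)]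
    have h1 := Real.sq_sqrt (show 0 ≤ y ^ 2 + 4 by positivity)
    have h2 : |y| ≤ √(y ^ 2 + 4) := Real.le_sqrt_of_sq_le (by rw [sq_abs]; linarith)
    -- This bounds the cross term of `x² = y² + 2y(x - y) + (x - y)²` when the claim is squared.
    have h3 : y * (x - y) ≤ √(y ^ 2 + 4) * |x - y| :=
      (le_abs_self _).trans (by rw [abs_mul]; gcongr)
    nlinarith [sq_abs (x - y)]
  have := le_abs_self (x - y)
  unfold posRoot
  linarith

lemma memJNQ_iff_exists_sub_one_div {α p q : ℝ} (hp : 1 ≤ p) (hq : 1 ≤ q)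
    (f : EuclideanSpace ℝ (Fin n) → ℝ) :
    MemJNQ α p q f ↔
      ∃ g : EuclideanSpace ℝ (Fin n) → ℝ, MemJNQ α p q g ∧
        (∀ᵐ x ∂volume, g x ≠ 0) ∧ MemJNQ α p q (fun x => 1 / g x) ∧
        ∀ᵐ x ∂volume, f x = g x - 1 / g x := by
  constructor
  · intro hf
    have hp0 : 0 < p := by linarith
    have hq0 : 0 < q := by linarith
    obtain ⟨_, h1⟩ := lipschitzWith_posRoot.leftCompBounded (n := n) (α := α) hp0 hq0
    obtain ⟨_, h2⟩ := (lipschitzWith_posRoot.comp LipschitzWith.id.neg).leftCompBounded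
      (n := n) (α := α) hp0 hq0
    refine ⟨fun x => posRoot (f x), (h1 f hf).1,
      Filter.Eventually.of_forall fun x => (posRoot_pos _).ne', ?_,
      Filter.Eventually.of_forall fun x => (posRoot_sub_one_div _).symm⟩
    simp only [one_div_posRoot]
    exact (h2 f hf).1
  · rintro ⟨g, hg, -, hg', hfg⟩
    exact (hg.sub hp hq hg').congr_ae (Filter.EventuallyEq.symm hfg)

/-! ### Necessity of the Lipschitz condition -/

lemma exists_bump (n : ℕ) : ∃ φ : EuclideanSpace ℝ (Fin n) → ℝ, Continuous φ ∧
    (∀ x, ‖x‖ ≤ 1 → φ x = 1) ∧ (∀ x, 2 ≤ ‖x‖ → φ x = 0) ∧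
    ∀ x y, ‖φ x - φ y‖ₑ ≤ min 1 ‖x - y‖ₑ := by
  refine ⟨fun x => max 0 (min 1 (2 - ‖x‖)), by fun_prop, fun x hx => ?_, fun x hx => ?_,
    fun x y => le_min ?_ ?_⟩
  · have h : (1 : ℝ) ≤ 2 - ‖x‖ := by linarith
    simp [h]
  · exact max_eq_left ((min_le_right _ _).trans (by linarith))
  · have h0 : ∀ u : ℝ, 0 ≤ max 0 (min 1 u) := fun u => le_max_left _ _
    have h1 : ∀ u : ℝ, max 0 (min 1 u) ≤ 1 := fun u => max_le zero_le_one (min_le_left _ _)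
    rw [← ofReal_norm, ← ENNReal.ofReal_one]
    refine ENNReal.ofReal_le_ofReal ?_
    rw [Real.norm_eq_abs, abs_le]
    constructor <;> linarith [h0 (2 - ‖x‖), h1 (2 - ‖x‖), h0 (2 - ‖y‖), h1 (2 - ‖y‖)]
  · rw [← ofReal_norm, ← ofReal_norm]
    refine ENNReal.ofReal_le_ofReal ?_
    rw [Real.norm_eq_abs]
    calc |max 0 (min 1 (2 - ‖x‖)) - max 0 (min 1 (2 - ‖y‖))|
        ≤ |min 1 (2 - ‖x‖) - min 1 (2 - ‖y‖)| := by
          simpa [max_comm] using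
            abs_max_sub_max_le_abs (min 1 (2 - ‖x‖)) (min 1 (2 - ‖y‖)) 0
      _ ≤ |(2 - ‖x‖) - (2 - ‖y‖)| := by
          have := abs_min_sub_min_le_max 1 (2 - ‖x‖) 1 (2 - ‖y‖)
          simpa using this
      _ = |‖y‖ - ‖x‖| := by congr 1; ring
      _ ≤ ‖x - y‖ := by rw [norm_sub_rev]; exact abs_norm_sub_norm_le y x

/-- On `A × B` the numerator is constant and the denominator is at most `w`; the rest of `Q × Q` is
discarded. -/
lemma enorm_sub_mul_le_jnqEnergy {f : EuclideanSpace ℝ (Fin n) → ℝ} {s t : ℝ} {q σ : ℝ}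
    {A B Q : Set (EuclideanSpace ℝ (Fin n))} (hA : MeasurableSet A) (hB : MeasurableSet B)
    (hAQ : A ⊆ Q) (hBQ : B ⊆ Q) (hfA : ∀ x ∈ A, f x = t) (hfB : ∀ x ∈ B, f x = s) {w : ℝ≥0∞}
    (hw : ∀ x ∈ A, ∀ y ∈ B, ‖x - y‖ₑ ^ σ ≤ w) :
    ‖t - s‖ₑ ^ q * (w⁻¹ * volume B * volume A) ≤ jnqEnergy f q σ Q := by
  calc ‖t - s‖ₑ ^ q * (w⁻¹ * volume B * volume A)
      = ∫⁻ _ in A, ∫⁻ _ in B, ‖t - s‖ₑ ^ q / w := by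
        simp only [setLIntegral_const, div_eq_mul_inv, mul_assoc]
    _ ≤ ∫⁻ x in A, ∫⁻ y in B, ‖f x - f y‖ₑ ^ q / ‖x - y‖ₑ ^ σ := by
        refine setLIntegral_mono' hA fun x hx => setLIntegral_mono' hB fun y hy => ?_
        rw [hfA x hx, hfB y hy]
        gcongr
        exact hw x hx y hy
    _ ≤ ∫⁻ x in A, ∫⁻ y in Q, ‖f x - f y‖ₑ ^ q / ‖x - y‖ₑ ^ σ :=
        lintegral_mono fun x => lintegral_mono_set hBQ
    _ ≤ _ := lintegral_mono_set hAQ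

lemma isCube_box (n : ℕ) (r : ℝ) :
    IsCube (2 * r) {x : EuclideanSpace ℝ (Fin n) | ∀ i, x i ∈ Icc (-r) r} :=
  ⟨fun _ => -r, fun _ => Icc (-r) r, fun i => by
    rw [show -r + 2 * r = r by ring]
    exact ⟨Ioo_subset_Icc_self, subset_rfl⟩, rfl⟩

lemma volume_mul_jnqPhi_le_jnqNorm {α p q : ℝ} (hp : 0 < p)
    (f : EuclideanSpace ℝ (Fin n) → ℝ) {ℓ : ℝ} (hℓ : 0 < ℓ)
    {Q : Set (EuclideanSpace ℝ (Fin n))} (hQ : IsCube ℓ Q) :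
    volume Q ^ (1 / p) * jnqPhi f q α Q ≤ jnqNorm α p q f := by
  have h : ({Q} : Set _) ∈ congruentCubes n ℓ :=
    ⟨by simpa using hQ, Set.pairwise_singleton _ _⟩
  have := tsum_le_jnqNorm_rpow (α := α) (q := q) f hp hℓ h
  rw [tsum_singleton Q (fun R => volume R * jnqPhi f q α R ^ p)] at this
  have h2 := ENNReal.rpow_le_rpow this (show 0 ≤ 1 / p by positivity)
  rwa [ENNReal.mul_rpow_of_nonneg _ _ (by positivity), ← ENNReal.rpow_mul, ← ENNReal.rpow_mul,
    mul_one_div_cancel hp.ne', ENNReal.rpow_one, ENNReal.rpow_one] at h2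

/-- A function that equals `t` on the unit ball and `s` off the ball of radius `2` has norm at
least a constant multiple of `|t - s|`. -/
lemma exists_pos_mul_enorm_sub_le_jnqNorm (hn : 1 ≤ n) (α : ℝ) {p q : ℝ} (hp : 0 < p)
    (hq : 0 < q) :
    ∃ κ : ℝ≥0∞, κ ≠ 0 ∧ ∀ (f : EuclideanSpace ℝ (Fin n) → ℝ) (s t : ℝ),
      (∀ x, ‖x‖ ≤ 1 → f x = t) → (∀ x, 2 ≤ ‖x‖ → f x = s) →
        κ * ‖t - s‖ₑ ≤ jnqNorm α p q f := by
  -- The ball of radius `1/2` about `e` lies in the shell `2 ≤ |y| ≤ 3`, and `[-3, 3]^n` contains it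
  -- together with the unit ball.
  set e : EuclideanSpace ℝ (Fin n) := EuclideanSpace.single ⟨0, hn⟩ (5 / 2 : ℝ)
  have he : ‖e‖ = 5 / 2 := by simp [e]
  set Q : Set (EuclideanSpace ℝ (Fin n)) := {x | ∀ i, x i ∈ Icc (-3 : ℝ) 3}
  have hQ : IsCube (2 * 3) Q := isCube_box n 3
  have hsub : ∀ x : EuclideanSpace ℝ (Fin n), ‖x‖ ≤ 3 → x ∈ Q := fun x hx i =>
    abs_le.1 ((PiLp.norm_apply_le x i).trans hx)
  have hvol := hQ.volume_eq
  have hv0 : volume Q ≠ 0 := by rw [hvol]; exact pow_ne_zero _ (by simp)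
  have hvtop : volume Q ≠ ∞ := by rw [hvol]; exact ENNReal.pow_ne_top ENNReal.ofReal_ne_top
  set A := Metric.ball (0 : EuclideanSpace ℝ (Fin n)) 1
  set B := Metric.ball e (1 / 2)
  have hA : ∀ x ∈ A, ‖x‖ < 1 := fun x hx => by simpa [A] using hx
  have hB : ∀ y ∈ B, 2 ≤ ‖y‖ ∧ ‖y‖ ≤ 3 := fun y hy => by
    have h : ‖y - e‖ < 1 / 2 := by simpa [B, dist_eq_norm] using hy
    have h1 := norm_sub_norm_le e y
    have h2 := norm_sub_norm_le y e
    rw [norm_sub_rev] at h1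
    constructor <;> linarith
  set σ : ℝ := n + q * α
  -- Distances between the two balls lie in `[1, 4]`; the absolute value covers negative `σ`.
  set w : ℝ≥0∞ := 4 ^ |σ|
  have hwtop : w ≠ ∞ := ENNReal.rpow_ne_top_of_nonneg (abs_nonneg _) (by simp)
  have hw : ∀ x ∈ A, ∀ y ∈ B, ‖x - y‖ₑ ^ σ ≤ w := fun x hx y hy => by
    have hx1 := hA x hx
    have hy1 := hB y hy
    have h1 : 1 ≤ ‖x - y‖ₑ := by
      rw [← ofReal_norm, ENNReal.one_le_ofReal]
      have := norm_sub_norm_le y x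
      rw [norm_sub_rev] at this
      linarith
    have h4 : ‖x - y‖ₑ ≤ 4 := by
      rw [← ofReal_norm, ENNReal.ofReal_le_iff_le_toReal (by simp)]
      have := norm_sub_le x y
      norm_num
      linarith
    calc ‖x - y‖ₑ ^ σ ≤ ‖x - y‖ₑ ^ |σ| := ENNReal.rpow_le_rpow_of_exponent_le h1 (le_abs_self _)
      _ ≤ w := ENNReal.rpow_le_rpow h4 (abs_nonneg _)
  have hA0 : volume A ≠ 0 := (Metric.measure_ball_pos _ _ one_pos).ne'
  have hB0 : volume B ≠ 0 := (Metric.measure_ball_pos _ _ (by norm_num)).ne'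
  set k : ℝ≥0∞ := volume Q ^ (q * α / n - 1) * (w⁻¹ * volume B * volume A) with hk
  have hk0 : k ≠ 0 := by
    refine mul_ne_zero (ENNReal.rpow_pos hv0.bot_lt hvtop).ne' ?_
    exact mul_ne_zero (mul_ne_zero (ENNReal.inv_ne_zero.2 hwtop) hB0) hA0
  refine ⟨volume Q ^ (1 / p) * k ^ (1 / q), mul_ne_zero (ENNReal.rpow_pos hv0.bot_lt hvtop).ne'
    (by rw [Ne, ENNReal.rpow_eq_zero_iff_of_pos (by positivity)]; exact hk0), ?_⟩
  intro f s t hft hfs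
  refine le_trans ?_ (volume_mul_jnqPhi_le_jnqNorm hp f (by norm_num) hQ)
  rw [mul_assoc, jnqPhi_eq]
  gcongr
  calc k ^ (1 / q) * ‖t - s‖ₑ = (k * ‖t - s‖ₑ ^ q) ^ (1 / q) := by
        rw [ENNReal.mul_rpow_of_nonneg k _ (by positivity), ← ENNReal.rpow_mul,
          mul_one_div_cancel hq.ne', ENNReal.rpow_one]
    _ ≤ _ := by
        rw [hk, mul_assoc, mul_comm _ (‖t - s‖ₑ ^ q)]
        gcongr
        exact enorm_sub_mul_le_jnqEnergy measurableSet_ball measurableSet_ball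
          (fun x hx => hsub x (by linarith [hA x hx])) (fun y hy => hsub y (hB y hy).2)
          (fun x hx => hft x (hA x hx).le) (fun y hy => hfs y (hB y hy).1) hw

lemma LeftCompBounded.exists_lipschitzWith (hn : 1 ≤ n) {α p q : ℝ} (hα : α < 1) (hp : 1 ≤ p)
    (hq : 1 ≤ q) (hpq : 1 / p + 1 / (n : ℝ) ≤ 1 / q) {L : ℝ → ℝ}
    (hL : LeftCompBounded n α p q L) : ∃ K : ℝ≥0, LipschitzWith K L := by
  have hp0 : 0 < p := by linarith
  have hq0 : 0 < q := by linarith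
  obtain ⟨φ, hφc, hφ1, hφ0, hφ⟩ := exists_bump n
  have hN : jnqNorm α p q φ < ∞ :=
    jnqNorm_lt_top_of_support_subset hn hα hp hq hpq (Metric.isOpen_ball.measurableSet)
      (measure_ball_lt_top (x := 0) (r := 2)).ne (fun x hx => hφ0 x (by simpa using hx)) hφ
  obtain ⟨κ, hκ0, hκ⟩ := exists_pos_mul_enorm_sub_le_jnqNorm hn α hp0 hq0
  obtain ⟨C, hC⟩ := hL
  set N := jnqNorm α p q φ
  set K : ℝ≥0∞ := C * N / κ
  have hK : K ≠ ∞ := ENNReal.div_ne_top (ENNReal.mul_ne_top ENNReal.coe_ne_top hN.ne) hκ0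
  refine ⟨K.toNNReal, fun t s => ?_⟩
  rw [ENNReal.coe_toNNReal hK, edist_eq_enorm_sub, edist_eq_enorm_sub]
  set f : EuclideanSpace ℝ (Fin n) → ℝ := fun x => s + (t - s) * φ x
  have hfN : jnqNorm α p q f ≤ ‖t - s‖₊ * N :=
    jnqNorm_le_mul hp0 hq0 _ fun x y => by
      rw [show f x - f y = (t - s) * (φ x - φ y) by simp only [f]; ring, enorm_mul]
      rfl
  have hfm : MemJNQ α p q f := ⟨(by fun_prop : Continuous f).measurable.aemeasurable,
    hfN.trans_lt (ENNReal.mul_lt_top ENNReal.coe_lt_top hN)⟩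
  have h : κ * ‖L t - L s‖ₑ ≤ C * N * ‖t - s‖ₑ := calc
    κ * ‖L t - L s‖ₑ ≤ jnqNorm α p q (fun x => L (f x)) :=
        hκ _ _ _ (fun x hx => by simp [f, hφ1 x hx]) (fun x hx => by simp [f, hφ0 x hx])
    _ ≤ C * jnqNorm α p q f := (hC f hfm).2
    _ ≤ C * (‖t - s‖₊ * N) := by gcongr
    _ = (C * N) * ‖t - s‖ₑ := by rw [enorm_eq_nnnorm]; ring
  -- Only `κ ≠ 0` is known; if `κ = ∞`, the finite right side of `h` forces `L t = L s`.
  rcases eq_or_ne κ ∞ with rfl | hκtop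
  · have hfin : (C * N : ℝ≥0∞) * ‖t - s‖ₑ < ∞ := ENNReal.mul_lt_top
      (ENNReal.mul_lt_top ENNReal.coe_lt_top hN) enorm_lt_top
    rcases eq_or_ne ‖L t - L s‖ₑ 0 with h0 | h0
    · simp [h0]
    · exact absurd (h.trans_lt hfin) (by simp [ENNReal.top_mul h0])
  · rw [ENNReal.mul_comm_div, ← mul_div_assoc, ENNReal.le_div_iff_mul_le (.inl hκ0) (.inl hκtop),
      mul_comm]
    exact h

end

theorem theorem4p1 (n : ℕ) (hn : 1 ≤ n) (α p q γ : ℝ) (hα : α < 1) (hp : 1 ≤ p) (hq : 1 ≤ q)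
    (hγq : q ≤ γ) (hγ : 1 / γ = 1 / p + 1 / (n : ℝ)) :
    (∀ L : ℝ → ℝ, Continuous L →
      (LeftCompBounded n α p q L ↔ ∃ K : ℝ≥0, LipschitzWith K L)) ∧
    (∀ f : EuclideanSpace ℝ (Fin n) → ℝ,
      MemJNQ α p q f ↔
        ∃ g : EuclideanSpace ℝ (Fin n) → ℝ, MemJNQ α p q g ∧
          (∀ᵐ x ∂volume, g x ≠ 0) ∧ MemJNQ α p q (fun x => 1 / g x) ∧
          ∀ᵐ x ∂volume, f x = g x - 1 / g x) := by
  have hq0 : 0 < q := by linarith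
  have hpq : 1 / p + 1 / (n : ℝ) ≤ 1 / q := hγ ▸ one_div_le_one_div_of_le hq0 hγq
  refine ⟨fun L _ => ⟨fun h => h.exists_lipschitzWith hn hα hp hq hpq, ?_⟩,
    memJNQ_iff_exists_sub_one_div hp hq⟩
  rintro ⟨K, hK⟩
  exact hK.leftCompBounded (by linarith) hq0
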